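/- Definitions. A coarse proximity space $(X,\mathcal B,\mathbf b)$ is a set $X$ with a bornology $\mathcal B$ (whose members are the bounded sets) and a symmetric relation $\mathbf b$ on subsets of $X$ such that: $A\mathbf bB$ implies that $A,B$ are unbounded; $A\cap B\notin\mathcal B$ implies $A\mathbf bB$; $(A\cup B)\mathbf bC$ iff $A\mathbf bC$ or $B\mathbf bC$; and if not $A\mathbf bB$, there is $E\subseteq X$ with neither $A\mathbf bE$ nor $(X\setminus E)\mathbf bB$. Its weak asymptotic resemblance is: $A\phi B$ iff $A\mathbf bB_0$ for every unbounded $B_0\subseteq B$ and $A_0\mathbf bB$ for every unbounded $A_0\subseteq A$. Its boundary $\mathcal UX$ is the subspace of the Smirnov compactification $\mathfrak X$ of $X$ with the proximity "$A\cap B\neq\emptyset$ or $A\mathbf bB$" that consists of the clusters containing no bounded set; the trace of $A\subseteq X$ is $A'=\mathrm{cl}_{\mathfrak X}(A)\cap\mathcal UX$. An asymptotic resemblance on $X$ is an equivalence relation $\lambda$ on the subsets of $X$ such that $A_1\lambda B_1$ and $A_2\lambda B_2$ imply $(A_1\cup A_2)\lambda(B_1\cup B_2)$, and such that if $(B_1\cup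 B_2)\lambda A$ with $B_1,B_2\ne\emptyset$, then $A=A_1\cup A_2$ with $A_i\neq\emptyset$ and $B_i\lambda A_i$ for $i=1,2$. It induces $(X,\mathcal B,\mathbf b)$ if $\mathcal B$ consists of $\emptyset$ and the sets $A$ with $A\lambda\{x\}$ for some $x\in X$, and $A\mathbf bB$ holds iff there are unbounded $A_0\subseteq A$, $B_0\subseteq B$ with $A_0\lambda B_0$. For coarse proximity spaces $(X,\mathcal B_X,\mathbf b_X)$, $(Y,\mathcal B_Y,\mathbf b_Y)$ and a homeomorphism $g:\mathcal UY\to\mathcal UX$, the stitched space is $X\sqcup Y$ with the bornology $\mathcal B_{X\sqcup Y}$ generated by $\mathcal B_X$ and $\mathcal B_Y$ and the relation: $A\mathbf b_gB$ iff $A,B$ are unbounded and $[(A\cap X)'\cup g((A\cap Y)')]\cap[(B\cap X)'\cup g((B\cap Y)')]\neq\emptyset$. The box space of a compact Hausdorff space $Z$ is $Z\times[0,1)$ with its precompact subsets as bounded sets, two sets being close iff their closures in $Z\times[0,1]$ meet in $Z\times\{1\}$. A metric space carries the bornology of its metrically bounded sets and the metric coarse proximity: $A\mathbf bB$ iff there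 is $\varepsilon<\infty$ such that for every bounded $D$ there are $a\in A\setminus D$, $c\in B\setminus D$ with $d(a,c)<\varepsilon$. The Higson corona is $\nu X=hX\setminus X$, where $hX$ is the Higson compactification. Statement. (1) There is a coarse proximity space that is not induced by any asymptotic resemblance. (2) If a coarse proximity space is induced by an asymptotic resemblance, and $A_1,B_1$ are unbounded with $A_1\mathbf bB_1$, then there are unbounded $A_2\subseteq A_1$, $B_2\subseteq B_1$ with $A_2\phi B_2$. (3) Let $X$ be an unbounded proper metric space. Then $X$ with its metric coarse proximity and the box space $Y=\nu X\times[0,1)$ are coarse proximity spaces, $\nu X\ne\emptyset$, there is a homeomorphism $\mathcal UX\cong\nu X$ carrying the trace of each $A\subseteq X$ onto $\mathrm{cl}_{hX}(A)\cap\nu X$, and there is a homeomorphism $k:\nu X\to\mathcal UY$, "$x\mapsto(x,1)$", such that for all $A\subseteq Y$ and $x\in\nu X$: $k(x)\in A'$ iff $(x,1)\in\mathrm{cl}_{\nu X\times[0,1]}(A)$. For every homeomorphism $h:\mathcal UX\to\nu X$ and every such $k$, put $g=h^{-1}\circ k^{-1}:\mathcal UY\to\mathcal UX$. Then: (a) $(X\sqcup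 Y,\mathcal B_{X\sqcup Y},\mathbf b_g)$ is a coarse proximity space; (b) for every $x_0\in\nu X$, no unbounded $A\subseteq X$ satisfies $h(A')=\{x_0\}$; (c) for every $x_0\in\nu X$, the sets $A_1=\{x_0\}\times[0,1)\subseteq Y$ and $B_1=X$ are unbounded and $A_1\mathbf b_gB_1$, but there are no unbounded $A_2\subseteq A_1$, $B_2\subseteq B_1$ with $A_2\phi B_2$; (d) $(X\sqcup Y,\mathcal B_{X\sqcup Y},\mathbf b_g)$ is not induced by any asymptotic resemblance. -/

import Mathlib

open Set

/-- `A` is unbounded for the bornology `𝓑`. -/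
def IsUnbounded {X : Type*} (𝓑 : Bornology X) (A : Set X) : Prop :=
  ¬ @Bornology.IsBounded X 𝓑 A

/-- The relation `b` is a coarse proximity on the set `X` with bornology `𝓑`. -/
structure IsCoarseProximity {X : Type*} (𝓑 : Bornology X) (b : Set X → Set X → Prop) : Prop where
  symm : ∀ A B, b A B → b B A
  unbounded : ∀ A B, b A B → IsUnbounded 𝓑 A ∧ IsUnbounded 𝓑 B
  of_inter : ∀ A B, IsUnbounded 𝓑 (A ∩ B) → b A B
  union_left : ∀ A B C, b (A ∪ B) C ↔ b A C ∨ b B C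
  strong : ∀ A B, ¬ b A B → ∃ E : Set X, ¬ b A E ∧ ¬ b Eᶜ B

/-- The weak asymptotic resemblance relation of a coarse proximity space. -/
def WeakResemblance {X : Type*} (𝓑 : Bornology X) (b : Set X → Set X → Prop)
    (A B : Set X) : Prop :=
  (∀ B₀ ⊆ B, IsUnbounded 𝓑 B₀ → b A B₀) ∧ (∀ A₀ ⊆ A, IsUnbounded 𝓑 A₀ → b A₀ B)

/-! ### Asymptotic resemblance -/

/-- Asymptotic resemblance relations on the power set of `X`. -/
structure IsAsymptoticResemblance {X : Type*} (r : Set X → Set X → Prop) : Prop where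
  equivalence : Equivalence r
  union : ∀ A₁ A₂ B₁ B₂, r A₁ B₁ → r A₂ B₂ → r (A₁ ∪ A₂) (B₁ ∪ B₂)
  split : ∀ A B₁ B₂, r (B₁ ∪ B₂) A → B₁.Nonempty → B₂.Nonempty →
    ∃ A₁ A₂ : Set X, A₁.Nonempty ∧ A₂.Nonempty ∧ A = A₁ ∪ A₂ ∧ r B₁ A₁ ∧ r B₂ A₂

/-- The asymptotic resemblance `r` induces `(𝓑, b)`: the bounded sets are the empty set and the
sets that resemble a point, and two sets are close when they are not asymptotically disjoint, that
is, when they have unbounded subsets that resemble each other. -/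
def InducesCoarseProximity {X : Type*} (r : Set X → Set X → Prop)
    (𝓑 : Bornology X) (b : Set X → Set X → Prop) : Prop :=
  (∀ A : Set X, @Bornology.IsBounded X 𝓑 A ↔ A = ∅ ∨ ∃ x : X, r A {x}) ∧
  (∀ A B : Set X, b A B ↔
    ∃ A₀ ⊆ A, ∃ B₀ ⊆ B, IsUnbounded 𝓑 A₀ ∧ IsUnbounded 𝓑 B₀ ∧ r A₀ B₀)

/-- The coarse proximity structure `(𝓑, b)` is induced by some asymptotic resemblance. -/
def IsInducedByResemblance {X : Type*} (𝓑 : Bornology X) (b : Set X → Set X → Prop) : Prop :=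
  ∃ r : Set X → Set X → Prop, IsAsymptoticResemblance r ∧ InducesCoarseProximity r 𝓑 b

/-! ### The boundary of a coarse proximity space -/

/-- The discrete extension of `b`: the proximity whose Smirnov compactification is used. -/
def discreteExtension {X : Type*} (b : Set X → Set X → Prop) (A B : Set X) : Prop :=
  (A ∩ B).Nonempty ∨ b A B

/-- Clusters of a proximity relation `δ`. -/
structure IsCluster {X : Type*} (δ : Set X → Set X → Prop) (σ : Set (Set X)) : Prop where
  near : ∀ A ∈ σ, ∀ B ∈ σ, δ A B
  maximal : ∀ A, (∀ B ∈ σ, δ A B) → A ∈ σ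
  union : ∀ A B, A ∪ B ∈ σ → A ∈ σ ∨ B ∈ σ

/-- The points of the Smirnov compactification of `(X, discreteExtension b)`. -/
def Smirnov {X : Type*} (b : Set X → Set X → Prop) : Type _ :=
  {σ : Set (Set X) // IsCluster (discreteExtension b) σ}

/-- The topology of the Smirnov compactification: the sets of all clusters containing a given
`A ⊆ X` form a base of closed sets. By `Smirnov.mem_closure_iff` this is the topology of the proximity on
clusters that is defined through absorbing sets. -/
instance Smirnov.instTopologicalSpace {X : Type*} (b : Set X → Set X → Prop) :
    TopologicalSpace (Smirnov b) :=
  TopologicalSpace.generateFrom (range fun A : Set X => {σ : Smirnov b | A ∉ σ.1})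

theorem IsCluster.mono {X : Type*} {𝓑 : Bornology X} {b : Set X → Set X → Prop}
    (hb : IsCoarseProximity 𝓑 b) {σ : Set (Set X)} (hσ : IsCluster (discreteExtension b) σ)
    {A B : Set X} (hA : A ∈ σ) (hAB : A ⊆ B) : B ∈ σ := by
  refine hσ.maximal B fun C hC => ?_
  rcases hσ.near A hA C hC with h | h
  · exact Or.inl (h.mono (inter_subset_inter_left C hAB))
  · right
    rw [← union_eq_self_of_subset_left hAB]
    exact (hb.union_left A B C).2 (Or.inl h)

/-- A cluster `σ` lies in the closure of `𝒜` iff every set of `σ` is near every set absorbing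
`𝒜` (a set belonging to every cluster of `𝒜`). -/
theorem Smirnov.mem_closure_iff {X : Type*} {𝓑 : Bornology X} {b : Set X → Set X → Prop}
    (hb : IsCoarseProximity 𝓑 b) (𝒜 : Set (Smirnov b)) (σ : Smirnov b) :
    σ ∈ closure 𝒜 ↔
      ∀ A ∈ σ.1, ∀ C : Set X, (∀ τ ∈ 𝒜, C ∈ τ.1) → discreteExtension b A C := by
  have hbasis : TopologicalSpace.IsTopologicalBasis
      (range fun A : Set X => {σ : Smirnov b | A ∉ σ.1}) := by
    refine ⟨?_, ?_, ?_⟩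
    · rintro _ ⟨A, rfl⟩ _ ⟨B, rfl⟩ x ⟨hx1, hx2⟩
      refine ⟨{σ | A ∪ B ∉ σ.1}, ⟨A ∪ B, rfl⟩, ?_, ?_⟩
      · intro h
        exact (x.2.union A B h).elim hx1 hx2
      · intro y hy
        exact ⟨fun h => hy (y.2.mono hb h subset_union_left),
          fun h => hy (y.2.mono hb h subset_union_right)⟩
    · refine eq_univ_of_forall fun x => ⟨{σ | (∅ : Set X) ∉ σ.1}, ⟨∅, rfl⟩, fun h => ?_⟩
      rcases x.2.near ∅ h ∅ h with h | h
      · simp at h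
      · exact (hb.unbounded _ _ h).1 (@Bornology.isBounded_empty X 𝓑)
    · rfl
  rw [hbasis.mem_closure_iff]
  constructor
  · intro h A hA C hC
    by_contra hn
    have hCσ : C ∉ σ.1 := fun h => hn (σ.2.near A hA C h)
    obtain ⟨τ, h1, h2⟩ := h {τ | C ∉ τ.1} ⟨C, rfl⟩ hCσ
    exact h1 (hC τ h2)
  · rintro h _ ⟨C, rfl⟩ hσ
    by_contra hn
    refine hσ (σ.2.maximal C fun A hA => ?_)
    have := h A hA C fun τ hτ => by
      by_contra hc
      exact hn ⟨τ, hc, hτ⟩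
    rcases this with h' | h'
    · left; rwa [inter_comm]
    · right; exact hb.symm _ _ h'

/-- The copy of `A ⊆ X` in the Smirnov compactification: the point clusters at points of `A`. -/
def pointClusters {X : Type*} (b : Set X → Set X → Prop) (A : Set X) : Set (Smirnov b) :=
  {σ | ∃ x ∈ A, {x} ∈ σ.1}

/-- The boundary `𝒰X`: the clusters that contain no bounded set (with the subspace topology). -/
def coarseBoundary {X : Type*} (𝓑 : Bornology X) (b : Set X → Set X → Prop) : Set (Smirnov b) :=
  {σ | ∀ A ∈ σ.1, IsUnbounded 𝓑 A}

/-- The trace `A'` of `A ⊆ X`: the part of the closure of `A` that lies in the boundary. -/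
def coarseTrace {X : Type*} (𝓑 : Bornology X) (b : Set X → Set X → Prop) (A : Set X) :
    Set (coarseBoundary 𝓑 b) :=
  {σ | σ.1 ∈ closure (pointClusters b A)}

/-- The trace of `A` consists of the boundary clusters that contain `A`. -/
theorem mem_coarseTrace_iff {X : Type*} {𝓑 : Bornology X} {b : Set X → Set X → Prop}
    (hb : IsCoarseProximity 𝓑 b) (A : Set X) (σ : coarseBoundary 𝓑 b) :
    σ ∈ coarseTrace 𝓑 b A ↔ A ∈ σ.1.1 := by
  have hnb : ∀ (x : X) (C : Set X), ¬ b {x} C := fun x C h =>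
    (hb.unbounded _ _ h).1 (@Bornology.isBounded_singleton X 𝓑 x)
  refine (Smirnov.mem_closure_iff hb _ _).trans ⟨fun h => ?_, fun h C hC D hD => ?_⟩
  · refine σ.1.2.maximal A fun C hC => ?_
    have := h C hC A fun τ ⟨x, hx, hxτ⟩ => τ.2.mono hb hxτ (by simpa using hx)
    rcases this with h' | h'
    · left; rwa [inter_comm]
    · right; exact hb.symm _ _ h'
  · have hsub : A ⊆ D := fun x hx => by
      have hcl : IsCluster (discreteExtension b) {E : Set X | x ∈ E} := by
        refine ⟨fun E hE F hF => Or.inl ⟨x, hE, hF⟩, fun E hE => ?_, fun E F h => h⟩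
        rcases hE {x} rfl with ⟨y, hy, hyx⟩ | h'
        · rw [mem_singleton_iff] at hyx
          exact hyx ▸ hy
        · exact absurd (hb.symm _ _ h') (hnb x E)
      exact hD ⟨_, hcl⟩ ⟨x, hx, rfl⟩
    exact σ.1.2.near C hC D (σ.1.2.mono hb h hsub)

/-! ### Stitching along a homeomorphism of boundaries -/

/-- The bornology on `X ⊔ Y` generated by two bornologies. -/
abbrev stitchBornology {X Y : Type*} (𝓑X : Bornology X) (𝓑Y : Bornology Y) : Bornology (X ⊕ Y) :=
  Bornology.ofBounded
    {A | @Bornology.IsBounded X 𝓑X (Sum.inl ⁻¹' A) ∧ @Bornology.IsBounded Y 𝓑Y (Sum.inr ⁻¹' A)}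
    ⟨by simp, by simp⟩
    (fun _ hs _ hst => ⟨hs.1.subset (preimage_mono hst), hs.2.subset (preimage_mono hst)⟩)
    (fun _ hs _ ht => ⟨hs.1.union ht.1, hs.2.union ht.2⟩)
    (by
      rintro (x | y)
      · refine ⟨(Set.toFinite {x}).isBounded.subset ?_, (Set.toFinite ∅).isBounded.subset ?_⟩ <;>
          intro z <;> simp
      · refine ⟨(Set.toFinite ∅).isBounded.subset ?_, (Set.toFinite {y}).isBounded.subset ?_⟩ <;>
          intro z <;> simp)

/-- The trace of `A ⊆ X ⊔ Y` after the boundaries have been identified by `g`: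
`A'_X ∪ g(A'_Y)`. -/
def stitchTrace {X Y : Type*} {𝓑X : Bornology X} {bX : Set X → Set X → Prop}
    {𝓑Y : Bornology Y} {bY : Set Y → Set Y → Prop}
    (g : coarseBoundary 𝓑Y bY ≃ₜ coarseBoundary 𝓑X bX) (A : Set (X ⊕ Y)) :
    Set (coarseBoundary 𝓑X bX) :=
  coarseTrace 𝓑X bX (Sum.inl ⁻¹' A) ∪ g '' coarseTrace 𝓑Y bY (Sum.inr ⁻¹' A)

/-- The relation `b_g` on `X ⊔ Y`. -/
def stitchRel {X Y : Type*} {𝓑X : Bornology X} {bX : Set X → Set X → Prop}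
    {𝓑Y : Bornology Y} {bY : Set Y → Set Y → Prop}
    (g : coarseBoundary 𝓑Y bY ≃ₜ coarseBoundary 𝓑X bX) (A B : Set (X ⊕ Y)) : Prop :=
  IsUnbounded (stitchBornology 𝓑X 𝓑Y) A ∧ IsUnbounded (stitchBornology 𝓑X 𝓑Y) B ∧
    (stitchTrace g A ∩ stitchTrace g B).Nonempty

/-! ### Metric spaces and the Higson corona -/

/-- The bornology of metrically bounded sets. -/
abbrev metricBornology (X : Type*) [MetricSpace X] : Bornology X :=
  inferInstance

/-- The metric coarse proximity. -/
def metricRel (X : Type*) [MetricSpace X] (A B : Set X) : Prop :=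
  ∃ ε : ℝ, ∀ D : Set X, IsUnbounded (metricBornology X) D ∨
    ∃ a ∈ A \ D, ∃ c ∈ B \ D, dist a c < ε

/-- Higson functions: bounded continuous functions whose oscillation on balls of any fixed radius
vanishes at infinity. -/
def IsHigsonFunction {X : Type*} [MetricSpace X] (f : X → ℂ) : Prop :=
  Continuous f ∧ (∃ C : ℝ, ∀ x, ‖f x‖ ≤ C) ∧
  ∀ r > 0, ∀ ε > 0, ∃ K : Set X, IsCompact K ∧ ∀ x ∉ K, ∀ y, dist x y ≤ r → ‖f x - f y‖ < ε

/-- The evaluation map of `X` into the product of copies of `ℂ` indexed by Higson functions. -/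
def higsonMap (X : Type*) [MetricSpace X] (x : X) : {f : X → ℂ // IsHigsonFunction f} → ℂ :=
  fun f => f.1 x

/-- The Higson compactification: the closure of the image of the evaluation map. -/
def higsonCompactification (X : Type*) [MetricSpace X] :
    Set ({f : X → ℂ // IsHigsonFunction f} → ℂ) :=
  closure (range (higsonMap X))

/-- The Higson corona `νX`. -/
def higsonCorona (X : Type*) [MetricSpace X] : Set ({f : X → ℂ // IsHigsonFunction f} → ℂ) :=
  higsonCompactification X \ range (higsonMap X)

/-! ### The box space of a compact Hausdorff space -/

/-- The box space `Z × [0,1)`. -/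
abbrev Box (Z : Type*) : Type _ := Z × Ico (0 : ℝ) 1

/-- The inclusion `Z × [0,1) → Z × [0,1]`. -/
def boxInclusion (Z : Type*) (p : Box Z) : Z × Icc (0 : ℝ) 1 :=
  (p.1, ⟨p.2.1, p.2.2.1, p.2.2.2.le⟩)

/-- The point `(z, 1)` of `Z × [0,1]`. -/
def boxEnd {Z : Type*} (z : Z) : Z × Icc (0 : ℝ) 1 :=
  (z, ⟨1, zero_le_one, le_rfl⟩)

/-- The bornology of the precompact subsets of `Z × [0,1)`. -/
abbrev boxBornology (Z : Type*) [TopologicalSpace Z] [R1Space Z] : Bornology (Box Z) :=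
  Bornology.relativelyCompact (Box Z)

/-- Two subsets of the box space are close if their closures in `Z × [0,1]` meet in `Z × {1}`. -/
def boxRel (Z : Type*) [TopologicalSpace Z] (A B : Set (Box Z)) : Prop :=
  ∃ z : Z, boxEnd z ∈ closure (boxInclusion Z '' A) ∧ boxEnd z ∈ closure (boxInclusion Z '' B)

/-! ### The spaces and identifications of the example -/

/-- The boundary of the metric coarse proximity space `X`. -/
abbrev metricBoundary (X : Type*) [MetricSpace X] : Set (Smirnov (metricRel X)) :=
  coarseBoundary (metricBornology X) (metricRel X)

/-- The boundary of the box space over `Z`. -/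
abbrev boxBoundary (Z : Type*) [TopologicalSpace Z] [R1Space Z] : Set (Smirnov (boxRel Z)) :=
  coarseBoundary (boxBornology Z) (boxRel Z)

/-- `h : 𝒰X → νX` is the canonical identification: it carries the trace of each `A ⊆ X` to the
part of the closure of `A` in the Higson compactification that lies in the corona. -/
def IsHigsonIdentification {X : Type*} [MetricSpace X]
    (h : metricBoundary X ≃ₜ higsonCorona X) : Prop :=
  ∀ (A : Set X) (σ : metricBoundary X),
    σ ∈ coarseTrace (metricBornology X) (metricRel X) A ↔ (h σ).1 ∈ closure (higsonMap X '' A)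

/-- `k : Z → 𝒰(Z × [0,1))` is the canonical identification `z ↦ (z, 1)`: for each
`A ⊆ Z × [0,1)`, the point `k z` is in the trace of `A` iff `(z, 1)` is in the closure of `A` in
`Z × [0,1]`. -/
def IsBoxIdentification {Z : Type*} [TopologicalSpace Z] [R1Space Z]
    (k : Z ≃ₜ boxBoundary Z) : Prop :=
  ∀ (A : Set (Box Z)) (z : Z),
    k z ∈ coarseTrace (boxBornology Z) (boxRel Z) A ↔ boxEnd z ∈ closure (boxInclusion Z '' A)

/-- The homeomorphism of boundaries along which `X` and `νX × [0,1)` are stitched. -/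
noncomputable def coronaGluing {X : Type*} [MetricSpace X] (h : metricBoundary X ≃ₜ higsonCorona X)
    (k : higsonCorona X ≃ₜ boxBoundary (higsonCorona X)) :
    boxBoundary (higsonCorona X) ≃ₜ metricBoundary X :=
  k.symm.trans h.symm

/-- The bornology of the stitched space `X ⊔ (νX × [0,1))`. -/
noncomputable abbrev exampleBornology (X : Type*) [MetricSpace X] : Bornology (X ⊕ Box (higsonCorona X)) :=
  stitchBornology (metricBornology X) (boxBornology (higsonCorona X))

/-- The coarse proximity of the stitched space `X ⊔ (νX × [0,1))`. -/
abbrev exampleRel {X : Type*} [MetricSpace X] (h : metricBoundary X ≃ₜ higsonCorona X)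
    (k : higsonCorona X ≃ₜ boxBoundary (higsonCorona X)) :
    Set (X ⊕ Box (higsonCorona X)) → Set (X ⊕ Box (higsonCorona X)) → Prop :=
  stitchRel (coronaGluing h k)

/-!
A coarse proximity space is conveniently described by a *trace map*: an assignment `T` of a closed
subset of a compact Hausdorff space `Z` to each subset of `X`, which is additive, vanishes exactly
on the bounded sets, is onto `Z` for `X` itself, and such that disjoint closed subsets of `Z` can be
separated by a subset of `X` (`IsTraceMap`). Meeting of traces is then a coarse proximity
(`IsTraceMap.isCoarseProximity`), and its boundary is canonically homeomorphic to `Z`, with `T` as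
its trace (`IsTraceMap.exists_homeomorph`): a boundary cluster is the family of all sets whose trace
contains a given point, by a compactness argument.

Trace maps arise from maps of `X` and `Z` into a common Hausdorff space by `A ↦ Z ∩ cl A`
(`isTraceMap_closure`). For the box space that common space is `Z × [0,1]`; for a proper metric
space it is the product containing the Higson compactification. There, closeness of sets amounts to
traces meeting (`metricRel_iff_higsonTrace`): sets that are close at scale `ε` along an unbounded
set cannot be told apart by Higson functions, and for sets `A`, `B` that are not close the function
`d(·, A) / (d(·, A) + d(·, B) + 1)` is a Higson function that separates the traces. Two trace maps
whose targets are identified by a homeomorphism are glued by taking the union of the traces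
(`IsTraceMap.sum`), so stitched spaces are coarse proximity spaces.

Every unbounded set of a metric space contains a sequence that spreads out, whose even and odd terms
are not close. So the trace of an unbounded set of `X` has two disjoint nonempty subsets which are
themselves traces of unbounded subsets (`exists_unbounded_subset_notMem_coarseTrace`). An unbounded
subset of `{x₀} × [0,1)` has a single point as its trace, hence it cannot weakly resemble an
unbounded subset of `X`. In a space induced by an asymptotic resemblance, on the other hand, sets
that resemble each other resemble each other weakly, by the splitting axiom
(`InducesCoarseProximity.exists_weakResemblance`), so the stitched space is not induced.
The case `X = ℝ` gives a coarse proximity space that is not induced.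
-/

/-! ### Induced spaces have weakly resembling subsets -/

theorem IsUnbounded.mono {X : Type*} {𝓑 : Bornology X} {A B : Set X} (hA : IsUnbounded 𝓑 A)
    (h : A ⊆ B) : IsUnbounded 𝓑 B :=
  fun hB => hA (hB.subset h)

/-- If `A` resembles `B`, each unbounded subset of `B` resembles a subset of `A`, which is then
unbounded too. -/
theorem InducesCoarseProximity.rel_of_subset {W : Type*} {𝓑 : Bornology W}
    {b r : Set W → Set W → Prop} (hr : IsAsymptoticResemblance r)
    (hi : InducesCoarseProximity r 𝓑 b) {A B B₀ : Set W} (hAB : r A B)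
    (hA : IsUnbounded 𝓑 A) (hB₀ : B₀ ⊆ B) (hu : IsUnbounded 𝓑 B₀) : b A B₀ := by
  have key : ∃ A₀ ⊆ A, A₀.Nonempty ∧ r B₀ A₀ := by
    rcases (B \ B₀).eq_empty_or_nonempty with he | hne
    · obtain rfl : B₀ = B := hB₀.antisymm (sdiff_eq_empty.1 he)
      refine ⟨A, Subset.rfl, ?_, hr.equivalence.symm hAB⟩
      exact nonempty_iff_ne_empty.2 fun h => hA ((hi.1 A).2 (Or.inl h))
    · have h0 : B₀.Nonempty :=
        nonempty_iff_ne_empty.2 fun h => hu ((hi.1 B₀).2 (Or.inl h))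
      obtain ⟨A₁, A₂, h1, -, hA12, hr1, -⟩ := hr.split A B₀ (B \ B₀)
        (by rw [union_sdiff_cancel hB₀]; exact hr.equivalence.symm hAB) h0 hne
      exact ⟨A₁, hA12 ▸ subset_union_left, h1, hr1⟩
  obtain ⟨A₀, hA₀, hne, hr0⟩ := key
  refine (hi.2 A B₀).2 ⟨A₀, hA₀, B₀, Subset.rfl, fun hbd => ?_, hu, hr.equivalence.symm hr0⟩
  rcases (hi.1 A₀).1 hbd with h | ⟨x, hx⟩
  · exact hne.ne_empty h
  · exact hu ((hi.1 B₀).2 (Or.inr ⟨x, hr.equivalence.trans hr0 hx⟩))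

theorem InducesCoarseProximity.exists_weakResemblance {W : Type*} {𝓑 : Bornology W}
    {b r : Set W → Set W → Prop} (hb : IsCoarseProximity 𝓑 b) (hr : IsAsymptoticResemblance r)
    (hi : InducesCoarseProximity r 𝓑 b) {A₁ B₁ : Set W} (h : b A₁ B₁) :
    ∃ A₂ ⊆ A₁, ∃ B₂ ⊆ B₁, IsUnbounded 𝓑 A₂ ∧ IsUnbounded 𝓑 B₂ ∧ WeakResemblance 𝓑 b A₂ B₂ := by
  obtain ⟨A₂, hA, B₂, hB, hAu, hBu, hAB⟩ := (hi.2 A₁ B₁).1 h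
  exact ⟨A₂, hA, B₂, hB, hAu, hBu, fun B₀ h0 hu => hi.rel_of_subset hr hAB hAu h0 hu,
    fun A₀ h0 hu => hb.symm _ _ (hi.rel_of_subset hr (hr.equivalence.symm hAB) hBu h0 hu)⟩

/-! ### Trace maps -/

/-- `T` assigns to each subset of `X` a closed subset of `Z`, its set of points at infinity, so that
the bounded sets are those without points at infinity. In `separate`, disjoint closed sets `P`, `Q`
of points at infinity are separated by a set `E` that stays away from `P` and whose complement
stays away from `Q`. -/
structure IsTraceMap {X Z : Type*} [TopologicalSpace Z] (𝓑 : Bornology X)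
    (T : Set X → Set Z) : Prop where
  isClosed : ∀ A, IsClosed (T A)
  union : ∀ A B, T (A ∪ B) = T A ∪ T B
  univ : T univ = univ
  eq_empty_iff : ∀ A, T A = ∅ ↔ @Bornology.IsBounded X 𝓑 A
  separate : ∀ P Q, IsClosed P → IsClosed Q → Disjoint P Q →
    ∃ E, Disjoint (T E) P ∧ Disjoint (T Eᶜ) Q

namespace IsTraceMap

variable {X Z : Type*} [TopologicalSpace Z] {𝓑 : Bornology X} {T : Set X → Set Z}

theorem mono (hT : IsTraceMap 𝓑 T) {A B : Set X} (h : A ⊆ B) : T A ⊆ T B := by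
  rw [← union_eq_self_of_subset_left h, hT.union]
  exact subset_union_left

theorem nonempty_iff (hT : IsTraceMap 𝓑 T) {A : Set X} : (T A).Nonempty ↔ IsUnbounded 𝓑 A := by
  rw [nonempty_iff_ne_empty, ne_eq, hT.eq_empty_iff, IsUnbounded]

theorem mem_or_mem_compl (hT : IsTraceMap 𝓑 T) (A : Set X) (z : Z) : z ∈ T A ∨ z ∈ T Aᶜ := by
  have : z ∈ T (A ∪ Aᶜ) := by rw [union_compl_self, hT.univ]; trivial
  rwa [hT.union] at this

theorem isCoarseProximity (hT : IsTraceMap 𝓑 T) {b : Set X → Set X → Prop}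
    (hb : ∀ A B, b A B ↔ (T A ∩ T B).Nonempty) : IsCoarseProximity 𝓑 b where
  symm A B h := by rw [hb] at h ⊢; rwa [inter_comm]
  unbounded A B h := by
    rw [hb] at h
    exact ⟨hT.nonempty_iff.1 h.left, hT.nonempty_iff.1 h.right⟩
  of_inter A B h := (hb A B).2 <| (hT.nonempty_iff.2 h).mono <|
    subset_inter (hT.mono inter_subset_left) (hT.mono inter_subset_right)
  union_left A B C := by rw [hb, hb, hb, hT.union, union_inter_distrib_right, union_nonempty]
  strong A B h := by
    rw [hb, not_nonempty_iff_eq_empty, ← disjoint_iff_inter_eq_empty] at h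
    obtain ⟨E, h1, h2⟩ := hT.separate _ _ (hT.isClosed A) (hT.isClosed B) h
    refine ⟨E, ?_, ?_⟩ <;> rw [hb, not_nonempty_iff_eq_empty, ← disjoint_iff_inter_eq_empty]
    exacts [h1.symm, h2]

theorem comp_homeomorph (hT : IsTraceMap 𝓑 T) {Z' : Type*} [TopologicalSpace Z'] (h : Z' ≃ₜ Z) :
    IsTraceMap 𝓑 fun A => h ⁻¹' T A where
  isClosed A := (hT.isClosed A).preimage h.continuous
  union A B := by rw [hT.union, preimage_union]
  univ := by rw [hT.univ, preimage_univ]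
  eq_empty_iff A := by
    rw [← hT.eq_empty_iff, preimage_eq_empty_iff, h.surjective.range_eq, disjoint_univ]
  separate P Q hP hQ hPQ := by
    obtain ⟨E, h1, h2⟩ := hT.separate (h '' P) (h '' Q) (h.isClosedMap _ hP) (h.isClosedMap _ hQ)
      ((disjoint_image_iff h.injective).2 hPQ)
    refine ⟨E, ?_, ?_⟩
    · simpa [h.injective.preimage_image] using h1.preimage h
    · simpa [h.injective.preimage_image] using h2.preimage h

/-- Trace maps with the same target combine to a trace map on the disjoint union. -/
theorem sum {Y : Type*} {𝓑Y : Bornology Y} {S : Set Y → Set Z} (hT : IsTraceMap 𝓑 T)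
    (hS : IsTraceMap 𝓑Y S) : IsTraceMap (stitchBornology 𝓑 𝓑Y)
      fun A : Set (X ⊕ Y) => T (Sum.inl ⁻¹' A) ∪ S (Sum.inr ⁻¹' A) where
  isClosed A := (hT.isClosed _).union (hS.isClosed _)
  union A B := by
    simp only [preimage_union, hT.union, hS.union]
    exact union_union_union_comm _ _ _ _
  univ := by simp [hT.univ]
  eq_empty_iff A := by
    rw [union_empty_iff, hT.eq_empty_iff, hS.eq_empty_iff]
    exact (Bornology.isBounded_ofBounded_iff {A : Set (X ⊕ Y) |
      @Bornology.IsBounded X 𝓑 (Sum.inl ⁻¹' A) ∧ @Bornology.IsBounded Y 𝓑Y (Sum.inr ⁻¹' A)}).symm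
  separate P Q hP hQ hPQ := by
    obtain ⟨E, h1, h2⟩ := hT.separate P Q hP hQ hPQ
    obtain ⟨F, h3, h4⟩ := hS.separate P Q hP hQ hPQ
    refine ⟨Sum.inl '' E ∪ Sum.inr '' F, ?_, ?_⟩
    · have e1 : (Sum.inl ⁻¹' (Sum.inl '' E ∪ Sum.inr '' F : Set (X ⊕ Y))) = E := by ext; simp
      have e2 : (Sum.inr ⁻¹' (Sum.inl '' E ∪ Sum.inr '' F : Set (X ⊕ Y))) = F := by ext; simp
      simp only [e1, e2]
      exact h1.union_left h3
    · have e1 : (Sum.inl ⁻¹' (Sum.inl '' E ∪ Sum.inr '' F : Set (X ⊕ Y))ᶜ) = Eᶜ := by ext; simp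
      have e2 : (Sum.inr ⁻¹' (Sum.inl '' E ∪ Sum.inr '' F : Set (X ⊕ Y))ᶜ) = Fᶜ := by ext; simp
      simp only [e1, e2]
      exact h2.union_left h4

/-! ### The boundary of a space given by a trace map -/

/-- The sets whose trace contains `z` form a cluster. -/
theorem isCluster (hT : IsTraceMap 𝓑 T) [T1Space Z] {b : Set X → Set X → Prop}
    (hb : ∀ A B, b A B ↔ (T A ∩ T B).Nonempty) (z : Z) :
    IsCluster (discreteExtension b) {A | z ∈ T A} where
  near A hA B hB := Or.inr ((hb A B).2 ⟨z, hA, hB⟩)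
  maximal A hA := by
    by_contra hz
    obtain ⟨E, h1, h2⟩ := hT.separate {z} (T A) isClosed_singleton (hT.isClosed A)
      (disjoint_singleton_left.2 hz)
    have hEc : z ∈ T Eᶜ := (hT.mem_or_mem_compl E z).resolve_left (disjoint_singleton_right.1 h1)
    -- Nearness also holds for sets that intersect, so `Eᶜ` is replaced by a set disjoint from `A`.
    have hEA : z ∈ T (Eᶜ \ A) := by
      have : z ∈ T (Eᶜ \ A ∪ Eᶜ ∩ A) := by rwa [sdiff_union_inter]
      rw [hT.union] at this
      exact this.resolve_right fun h => hz (hT.mono inter_subset_right h)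
    rcases hA _ hEA with ⟨x, hx, -, hx'⟩ | h
    · exact hx' hx
    · obtain ⟨w, hw, hw'⟩ := (hb _ _).1 h
      exact disjoint_left.1 h2 (hT.mono sdiff_subset hw') hw
  union A B h := by
    rw [mem_ofPred_eq, hT.union] at h
    exact h

/-- A boundary cluster has a point at infinity that is common to all its members. -/
theorem exists_forall_mem (hT : IsTraceMap 𝓑 T) [CompactSpace Z] [T2Space Z]
    {b : Set X → Set X → Prop} (hb : ∀ A B, b A B ↔ (T A ∩ T B).Nonempty)
    {σ : Set (Set X)} (hσ : IsCluster (discreteExtension b) σ)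
    (hu : ∀ A ∈ σ, IsUnbounded 𝓑 A) : ∃ z, ∀ A ∈ σ, z ∈ T A := by
  have hcp := hT.isCoarseProximity hb
  by_contra! hcon
  -- Each `z` has a neighbourhood `N` that misses the trace of a set `E` with `Eᶜ ∉ σ`.
  have key : ∀ z : Z, ∃ N ∈ nhds z, ∃ E, Disjoint (T E) N ∧ Eᶜ ∉ σ := by
    intro z
    obtain ⟨A, hA, hz⟩ := hcon z
    obtain ⟨N, hN, hNc, hNA⟩ := exists_mem_nhds_isClosed_subset
      ((hT.isClosed A).isOpen_compl.mem_nhds hz)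
    obtain ⟨E, h1, h2⟩ := hT.separate N (T A) hNc (hT.isClosed A)
      (disjoint_left.2 fun w hw hw' => hNA hw hw')
    refine ⟨N, hN, E, h1, fun hE => ?_⟩
    rcases hσ.union (Eᶜ \ A) (Eᶜ ∩ A) (by rwa [sdiff_union_inter]) with h | h
    · rcases hσ.near _ h _ hA with ⟨x, hx, hx'⟩ | h
      · exact hx.2 hx'
      · obtain ⟨w, hw, hw'⟩ := (hb _ _).1 h
        exact disjoint_left.1 h2 (hT.mono sdiff_subset hw) hw'
    · obtain ⟨w, hw⟩ := hT.nonempty_iff.2 (hu _ h)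
      exact disjoint_left.1 h2 (hT.mono inter_subset_left hw) (hT.mono inter_subset_right hw)
  choose N hN E hE hEσ using key
  obtain ⟨t, ht⟩ := CompactSpace.elim_nhds_subcover N hN
  have huniv : (Set.univ : Set X) ∈ σ := by
    refine hσ.maximal _ fun B hB => Or.inl ?_
    rw [univ_inter]
    exact nonempty_iff_ne_empty.2 fun h => hu B hB (h ▸ @Bornology.isBounded_empty X 𝓑)
  have hind : ∀ s : Finset Z, (⋂ z ∈ s, E z) ∈ σ := by
    classical
    intro s
    induction s using Finset.induction_on with
    | empty => simpa using huniv
    | insert a s _ ih =>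
      rw [Finset.set_biInter_insert]
      rcases hσ.union ((⋂ z ∈ s, E z) ∩ E a) ((⋂ z ∈ s, E z) \ E a)
        (by rwa [inter_union_sdiff]) with h | h
      · rwa [inter_comm]
      · exact absurd (hσ.mono hcp h fun x hx => hx.2) (hEσ a)
  obtain ⟨w, hw⟩ := hT.nonempty_iff.2 (hu _ (hind t))
  have hwt : w ∈ ⋃ z ∈ t, N z := by rw [ht]; trivial
  obtain ⟨z, hz, hwz⟩ := mem_iUnion₂.1 hwt
  exact disjoint_left.1 (hE z) (hT.mono (biInter_subset_of_mem hz) hw) hwz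

/-- The homeomorphism sends `z` to the cluster of all sets whose trace contains `z`. -/
theorem exists_homeomorph (hT : IsTraceMap 𝓑 T) [CompactSpace Z] [T2Space Z]
    {b : Set X → Set X → Prop} (hb : ∀ A B, b A B ↔ (T A ∩ T B).Nonempty) :
    ∃ h : Z ≃ₜ coarseBoundary 𝓑 b, ∀ A z, h z ∈ coarseTrace 𝓑 b A ↔ z ∈ T A := by
  have hcp := hT.isCoarseProximity hb
  let f : Z → coarseBoundary 𝓑 b := fun z =>
    ⟨⟨{A | z ∈ T A}, hT.isCluster hb z⟩, fun A hA => hT.nonempty_iff.1 ⟨z, hA⟩⟩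
  have hsep : ∀ z w, z ≠ w → ∃ E, z ∉ T E ∧ w ∉ T Eᶜ := fun z w hzw => by
    obtain ⟨E, h1, h2⟩ := hT.separate {z} {w} isClosed_singleton isClosed_singleton (by simpa)
    exact ⟨E, disjoint_singleton_right.1 h1, disjoint_singleton_right.1 h2⟩
  have hinj : Function.Injective f := by
    intro z w hzw
    by_contra hne
    obtain ⟨E, h1, h2⟩ := hsep z w hne
    have hset : {A | z ∈ T A} = {A | w ∈ T A} := congrArg (fun σ => σ.1.1) hzw
    exact h2 ((Set.ext_iff.1 hset Eᶜ).1 ((hT.mem_or_mem_compl E z).resolve_left h1))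
  have hsurj : Function.Surjective f := by
    rintro ⟨⟨σ, hσ⟩, hu⟩
    obtain ⟨z, hz⟩ := hT.exists_forall_mem hb hσ hu
    refine ⟨z, Subtype.ext (Subtype.ext (Subset.antisymm (fun A hA => ?_) hz))⟩
    exact hσ.maximal A fun B hB => Or.inr ((hb A B).2 ⟨z, hA, hz B hB⟩)
  have hcont : Continuous f := by
    refine Continuous.subtype_mk (continuous_generateFrom_iff.2 ?_) _
    rintro _ ⟨A, rfl⟩
    exact (hT.isClosed A).isOpen_compl
  have hopen : ∀ A : Set X, IsOpen {σ : coarseBoundary 𝓑 b | A ∉ σ.1.1} := fun A =>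
    (TopologicalSpace.isOpen_generateFrom_of_mem (mem_range_self A)).preimage continuous_subtype_val
  have ht2 : T2Space (coarseBoundary 𝓑 b) := by
    refine ⟨fun σ τ hne => ?_⟩
    obtain ⟨z, rfl⟩ := hsurj σ
    obtain ⟨w, rfl⟩ := hsurj τ
    obtain ⟨E, h1, h2⟩ := hsep z w fun h => hne (h ▸ rfl)
    refine ⟨_, _, hopen E, hopen Eᶜ, h1, h2, disjoint_left.2 fun σ h3 h4 => ?_⟩
    obtain ⟨v, rfl⟩ := hsurj σ
    exact (hT.mem_or_mem_compl E v).elim h3 h4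
  refine ⟨hcont.homeoOfEquivCompactToT2 (f := Equiv.ofBijective f ⟨hinj, hsurj⟩), fun A z => ?_⟩
  exact mem_coarseTrace_iff hcp A _

/-- The trace of a coarse proximity space given by a trace map is itself a trace map, with values in
the boundary. -/
theorem isTraceMap_coarseTrace (hT : IsTraceMap 𝓑 T) [CompactSpace Z] [T2Space Z]
    {b : Set X → Set X → Prop} (hb : ∀ A B, b A B ↔ (T A ∩ T B).Nonempty) :
    IsTraceMap 𝓑 (coarseTrace 𝓑 b) := by
  obtain ⟨h, hh⟩ := hT.exists_homeomorph hb
  have heq : coarseTrace 𝓑 b = fun A => h.symm ⁻¹' T A := by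
    ext A σ
    rw [mem_preimage, ← hh, h.apply_symm_apply]
  rw [heq]
  exact hT.comp_homeomorph h.symm

theorem isTraceMap_stitchTrace {Y : Type*} {𝓑Y : Bornology Y} {bX : Set X → Set X → Prop}
    {bY : Set Y → Set Y → Prop} (hX : IsTraceMap 𝓑 (coarseTrace 𝓑 bX))
    (hY : IsTraceMap 𝓑Y (coarseTrace 𝓑Y bY))
    (g : coarseBoundary 𝓑Y bY ≃ₜ coarseBoundary 𝓑 bX) :
    IsTraceMap (stitchBornology 𝓑 𝓑Y) (stitchTrace g) := by
  have heq : stitchTrace g = fun A => coarseTrace 𝓑 bX (Sum.inl ⁻¹' A) ∪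
      g.symm ⁻¹' coarseTrace 𝓑Y bY (Sum.inr ⁻¹' A) := by
    ext1 A
    rw [stitchTrace, g.image_eq_preimage_symm]
  rw [heq]
  exact hX.sum (hY.comp_homeomorph g.symm)

theorem stitchRel_iff {Y : Type*} {𝓑Y : Bornology Y} {bX : Set X → Set X → Prop}
    {bY : Set Y → Set Y → Prop} {g : coarseBoundary 𝓑Y bY ≃ₜ coarseBoundary 𝓑 bX}
    (hg : IsTraceMap (stitchBornology 𝓑 𝓑Y) (stitchTrace g)) (A B : Set (X ⊕ Y)) :
    stitchRel g A B ↔ (stitchTrace g A ∩ stitchTrace g B).Nonempty :=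
  ⟨fun h => h.2.2, fun h => ⟨hg.nonempty_iff.1 h.left, hg.nonempty_iff.1 h.right, h⟩⟩

end IsTraceMap

/-- Maps `i` of `X` and `e` of `Z` into a common Hausdorff space give the trace map
`A ↦ Z ∩ cl A`. -/
theorem isTraceMap_closure {X Z K : Type*} [TopologicalSpace Z] [CompactSpace Z]
    [TopologicalSpace K] [T2Space K] {𝓑 : Bornology X} (i : X → K) {e : Z → K}
    (he : Continuous e) (hinj : Function.Injective e) (hdense : ∀ z, e z ∈ closure (range i))
    (hbdd : ∀ A, e ⁻¹' closure (i '' A) = ∅ ↔ @Bornology.IsBounded X 𝓑 A) :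
    IsTraceMap 𝓑 fun A => e ⁻¹' closure (i '' A) where
  isClosed A := isClosed_closure.preimage he
  union A B := by rw [image_union, closure_union, preimage_union]
  univ := by
    rw [image_univ]
    exact eq_univ_of_forall hdense
  eq_empty_iff := hbdd
  separate P Q hP hQ hPQ := by
    obtain ⟨U, V, hU, hV, hPU, hQV, hUV⟩ := SeparatedNhds.of_isCompact_isCompact
      (hP.isCompact.image he) (hQ.isCompact.image he) ((disjoint_image_iff hinj).2 hPQ)
    refine ⟨(i ⁻¹' U)ᶜ, ?_, ?_⟩
    · refine disjoint_left.2 fun z hz hzP => ?_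
      have hsub : i '' (i ⁻¹' U)ᶜ ⊆ Uᶜ := image_subset_iff.2 fun x hx => hx
      exact closure_minimal hsub hU.isClosed_compl hz (hPU (mem_image_of_mem e hzP))
    · refine disjoint_left.2 fun z hz hzQ => ?_
      rw [compl_compl] at hz
      have hsub : i '' (i ⁻¹' U) ⊆ Vᶜ :=
        (image_preimage_subset i U).trans hUV.subset_compl_right
      exact closure_minimal hsub hV.isClosed_compl hz (hQV (mem_image_of_mem e hzQ))

/-! ### The box space -/

/-- The points at infinity of `A ⊆ Z × [0,1)`. -/
def boxTrace (Z : Type*) [TopologicalSpace Z] (A : Set (Box Z)) : Set Z :=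
  boxEnd ⁻¹' closure (boxInclusion Z '' A)

theorem boxEnd_mem_closure_fiber {Z : Type*} [TopologicalSpace Z] (z : Z) :
    boxEnd z ∈ closure (boxInclusion Z '' {p : Box Z | p.1 = z}) := by
  have hlim : Filter.Tendsto (fun n : ℕ => boxInclusion Z
      (z, ⟨1 - 1 / ((n : ℝ) + 1), by
        constructor
        · rw [sub_nonneg, div_le_one (by positivity)]; linarith [n.cast_nonneg (α := ℝ)]
        · rw [sub_lt_self_iff]; positivity⟩)) Filter.atTop (nhds (boxEnd z)) := by
    refine tendsto_const_nhds.prodMk_nhds (tendsto_subtype_rng.2 ?_)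
    simpa using (tendsto_const_nhds (x := (1 : ℝ))).sub
      (tendsto_one_div_add_atTop_nhds_zero_nat (𝕜 := ℝ))
  exact mem_closure_of_tendsto hlim (Filter.Eventually.of_forall fun n => mem_image_of_mem _ rfl)

theorem isTraceMap_boxTrace (Z : Type*) [TopologicalSpace Z] [CompactSpace Z] [T2Space Z] :
    IsTraceMap (boxBornology Z) (boxTrace Z) := by
  have hemb : Topology.IsEmbedding (boxInclusion Z) :=
    Topology.IsEmbedding.id.prodMap
      (Topology.IsEmbedding.inclusion (Ico_subset_Icc_self : Ico (0 : ℝ) 1 ⊆ Icc 0 1))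
  have hcont : Continuous (boxEnd : Z → Z × Icc (0 : ℝ) 1) := by
    unfold boxEnd; fun_prop
  have hne : ∀ (p : Box Z) z, boxInclusion Z p ≠ boxEnd z := fun p z h =>
    p.2.2.2.ne (congrArg (fun q : Z × Icc (0 : ℝ) 1 => (q.2 : ℝ)) h)
  refine isTraceMap_closure (boxInclusion Z) hcont
    (fun z w h => congrArg Prod.fst h) (fun z => ?_) fun A => ?_
  · exact closure_mono (image_subset_range _ _) (boxEnd_mem_closure_fiber z)
  · rw [Bornology.relativelyCompact.isBounded_iff]
    constructor
    · intro h
      have hrange : closure (boxInclusion Z '' A) ⊆ range (boxInclusion Z) := by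
        rintro ⟨z, t, ht0, ht1⟩ hzt
        rcases ht1.lt_or_eq with h1 | rfl
        · exact ⟨(z, ⟨t, ht0, h1⟩), rfl⟩
        · exact absurd hzt (eq_empty_iff_forall_notMem.1 h z)
      refine (hemb.isCompact_preimage' isClosed_closure.isCompact hrange).closure_of_subset ?_
      exact fun p hp => subset_closure (mem_image_of_mem _ hp)
    · intro h
      refine eq_empty_of_forall_notMem fun z hz => ?_
      obtain ⟨p, -, hp⟩ := closure_minimal (image_mono subset_closure)
        (h.image hemb.continuous).isClosed hz
      exact hne p z hp

theorem boxRel_iff_boxTrace {Z : Type*} [TopologicalSpace Z] (A B : Set (Box Z)) :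
    boxRel Z A B ↔ (boxTrace Z A ∩ boxTrace Z B).Nonempty :=
  Iff.rfl

/-! ### The metric coarse proximity and spreading sequences -/

theorem metricRel_iff {X : Type*} [MetricSpace X] {A B : Set X} :
    metricRel X A B ↔ ∃ ε : ℝ, ¬ Bornology.IsBounded (A ∩ Metric.thickening ε B) := by
  constructor
  · rintro ⟨ε, h⟩
    refine ⟨ε, fun hb => ?_⟩
    rcases h _ with h | ⟨a, ⟨haA, ha⟩, c, ⟨hc, -⟩, hac⟩
    · exact h hb
    · exact ha ⟨haA, Metric.mem_thickening_iff.2 ⟨c, hc, hac⟩⟩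
  · rintro ⟨ε, h⟩
    refine ⟨ε, fun D => ?_⟩
    by_contra! hcon
    obtain ⟨hD, hcon⟩ := hcon
    have hD' : Bornology.IsBounded D := not_not.1 hD
    refine h ((hD'.union (hD'.thickening (δ := ε))).subset ?_)
    rintro a ⟨ha, hat⟩
    obtain ⟨c, hc, hac⟩ := Metric.mem_thickening_iff.1 hat
    by_contra hn
    rw [mem_union, not_or] at hn
    refine absurd hac (not_lt.2 (hcon a ⟨ha, hn.1⟩ c ⟨hc, fun hcD => hn.2 ?_⟩))
    exact Metric.mem_thickening_iff.2 ⟨c, hcD, hac⟩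

theorem metricRel_symm {X : Type*} [MetricSpace X] {A B : Set X} (h : metricRel X A B) :
    metricRel X B A := by
  obtain ⟨ε, h⟩ := h
  exact ⟨ε, fun D => (h D).imp_right fun ⟨a, ha, c, hc, hac⟩ => ⟨c, hc, a, ha, by rwa [dist_comm]⟩⟩

/-- An unbounded set contains two unbounded subsets that are not close: the even and the odd terms
of a sequence that spreads out. -/
theorem exists_unbounded_not_metricRel {X : Type*} [MetricSpace X] {A : Set X}
    (hA : ¬ Bornology.IsBounded A) : ∃ A₁ ⊆ A, ∃ A₂ ⊆ A, ¬ Bornology.IsBounded A₁ ∧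
      ¬ Bornology.IsBounded A₂ ∧ ¬ metricRel X A₁ A₂ := by
  obtain ⟨x₀, -⟩ : A.Nonempty :=
    nonempty_iff_ne_empty.2 fun h => hA (h ▸ Bornology.isBounded_empty)
  have hfar : ∀ R : ℝ, ∃ a ∈ A, R < dist a x₀ := by
    by_contra! h
    obtain ⟨R, hR⟩ := h
    exact hA ((Metric.isBounded_iff_subset_closedBall x₀).2 ⟨R, hR⟩)
  choose f hfA hf using hfar
  let a : ℕ → X := fun n => Nat.rec (f 0) (fun n p => f (dist p x₀ + n + 1)) n
  have haA : ∀ n, a n ∈ A := fun n => by cases n <;> exact hfA _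
  have hstep : ∀ n, dist (a n) x₀ + n + 1 < dist (a (n + 1)) x₀ := fun n => hf _
  have hmono : Monotone fun n => dist (a n) x₀ :=
    monotone_nat_of_le_succ fun n => by
      have := hstep n
      have : (0 : ℝ) ≤ n := n.cast_nonneg
      linarith
  have hgap : ∀ m n, m < n → dist (a m) x₀ + n < dist (a n) x₀ := by
    intro m n hmn
    obtain ⟨k, rfl⟩ : ∃ k, n = k + 1 := ⟨n - 1, by omega⟩
    have h1 : dist (a m) x₀ ≤ dist (a k) x₀ := hmono (by omega)
    have h2 := hstep k
    push_cast
    linarith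
  have hdist : ∀ m n : ℕ, m ≠ n → (m : ℝ) < dist (a m) (a n) := by
    intro m n hmn
    rcases hmn.lt_or_gt with h | h
    · have h1 := hgap m n h
      have h2 := dist_triangle (a n) (a m) x₀
      have h3 : (m : ℝ) < n := by exact_mod_cast h
      rw [dist_comm (a n) (a m)] at h2
      linarith
    · have h1 := hgap n m h
      have h2 := dist_triangle (a m) (a n) x₀
      linarith
  have hunb : ∀ s : Set ℕ, (∀ N, ∃ n ∈ s, N < n) → ¬ Bornology.IsBounded (a '' s) := by
    intro s hs hbd
    obtain ⟨R, hR⟩ := (Metric.isBounded_iff_subset_closedBall x₀).1 hbd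
    obtain ⟨N, hN⟩ := exists_nat_gt R
    obtain ⟨n, hn, hNn⟩ := hs N
    have h1 : dist (a n) x₀ ≤ R := hR (mem_image_of_mem a hn)
    have h2 := hgap 0 n (by omega)
    have h3 : (N : ℝ) < n := by exact_mod_cast hNn
    linarith [dist_nonneg (x := a 0) (y := x₀)]
  refine ⟨a '' {n | Even n}, by rintro _ ⟨n, -, rfl⟩; exact haA n, a '' {n | Odd n},
    by rintro _ ⟨n, -, rfl⟩; exact haA n, hunb _ fun N => ⟨2 * (N + 1), by simp, by omega⟩,
    hunb _ fun N => ⟨2 * N + 1, by simp, by omega⟩, fun h => ?_⟩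
  obtain ⟨ε, hε⟩ := metricRel_iff.1 h
  obtain ⟨N, hN⟩ := exists_nat_gt ε
  refine hε (((finite_Iio N).image a).isBounded.subset ?_)
  rintro _ ⟨⟨m, hm, rfl⟩, ht⟩
  obtain ⟨_, ⟨n, hn, rfl⟩, hmn⟩ := Metric.mem_thickening_iff.1 ht
  have hne : m ≠ n := by
    rintro rfl
    exact Nat.not_even_iff_odd.2 hn hm
  refine mem_image_of_mem a (mem_Iio.2 ?_)
  exact_mod_cast (hdist m n hne).trans (hmn.trans hN)

/-! ### The Higson corona as a space of points at infinity -/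

section Higson

variable {X : Type*} [MetricSpace X]

theorem continuous_higsonMap : Continuous (higsonMap X) :=
  continuous_pi fun f => f.2.1

/-- The bump function at `x` is a Higson function. -/
theorem isHigsonFunction_bump [ProperSpace X] (x : X) :
    IsHigsonFunction fun y : X => ((max 0 (1 - dist y x) : ℝ) : ℂ) := by
  refine ⟨by fun_prop, ⟨1, fun y => ?_⟩, fun r hr ε hε =>
    ⟨Metric.closedBall x (1 + r), isCompact_closedBall _ _, fun y hy z hyz => ?_⟩⟩
  · rw [Complex.norm_real, Real.norm_of_nonneg (le_max_left _ _)]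
    exact max_le zero_le_one (by linarith [dist_nonneg (x := y) (y := x)])
  · rw [Metric.mem_closedBall, not_le] at hy
    have hz : 1 ≤ dist z x := by linarith [dist_triangle y z x]
    have hy' : 1 ≤ dist y x := by linarith
    simpa [hy', hz] using hε

theorem isCompact_higsonCompactification : IsCompact (higsonCompactification X) := by
  choose C hC using fun f : {f : X → ℂ // IsHigsonFunction f} => f.2.2.1
  refine (isCompact_univ_pi fun f => isCompact_closedBall (0 : ℂ) (C f)).closure_of_subset ?_
  rintro _ ⟨x, rfl⟩ f -
  simpa [higsonMap] using hC f x

theorem notMem_closure_of_isBounded [ProperSpace X] {D : Set X} (hD : Bornology.IsBounded D)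
    (z : higsonCorona X) : z.1 ∉ closure (higsonMap X '' D) := by
  intro hz
  obtain ⟨x, -, hx⟩ := closure_minimal (image_mono subset_closure)
    (hD.isCompact_closure.image continuous_higsonMap).isClosed hz
  exact z.2.2 ⟨x, hx⟩

theorem mem_closure_diff_of_isBounded [ProperSpace X] {A D : Set X} (hD : Bornology.IsBounded D)
    {z : higsonCorona X} (hz : z.1 ∈ closure (higsonMap X '' A)) :
    z.1 ∈ closure (higsonMap X '' (A \ D)) := by
  have h : z.1 ∈ closure (higsonMap X '' (A \ D ∪ D)) :=
    closure_mono (image_mono (by simp)) hz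
  rw [image_union, closure_union] at h
  exact h.resolve_right (notMem_closure_of_isBounded hD z)

instance compactSpace_higsonCorona [ProperSpace X] : CompactSpace (higsonCorona X) := by
  refine isCompact_iff_compactSpace.1 ?_
  -- The corona consists of the points of the compactification at which all bumps vanish.
  have heq : higsonCorona X = higsonCompactification X ∩
      ⋂ x : X, {z | z ⟨_, isHigsonFunction_bump x⟩ = 0} := by
    ext z
    constructor
    · refine fun hz => ⟨hz.1, mem_iInter.2 fun x => ?_⟩
      have hz' := mem_closure_diff_of_isBounded (A := univ) (z := ⟨z, hz⟩)
        (Metric.isBounded_ball (x := x) (r := 1)) (by rw [image_univ]; exact hz.1)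
      refine closure_minimal ?_ (isClosed_eq (continuous_apply _) continuous_const) hz'
      rintro _ ⟨y, ⟨-, hy⟩, rfl⟩
      rw [Metric.mem_ball, not_lt] at hy
      simp [higsonMap, hy]
    · rintro ⟨hz, hz'⟩
      refine ⟨hz, ?_⟩
      rintro ⟨x, rfl⟩
      have := mem_iInter.1 hz' x
      simp [higsonMap] at this
  rw [heq]
  exact isCompact_higsonCompactification.inter_right
    (isClosed_iInter fun x => isClosed_eq (continuous_apply _) continuous_const)

/-- The points at infinity of `A ⊆ X` in the Higson corona. -/
def higsonTrace (A : Set X) : Set (higsonCorona X) :=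
  Subtype.val ⁻¹' closure (higsonMap X '' A)

theorem isTraceMap_higsonTrace [ProperSpace X] :
    IsTraceMap (metricBornology X) (higsonTrace (X := X)) := by
  refine isTraceMap_closure (higsonMap X) continuous_subtype_val Subtype.val_injective
    (fun z => z.2.1) fun A => ⟨fun h => ?_, fun h => ?_⟩
  · have hsub : closure (higsonMap X '' A) ⊆ range (higsonMap X) := by
      intro z hz
      by_contra hn
      exact eq_empty_iff_forall_notMem.1 h
        ⟨z, closure_mono (image_subset_range _ _) hz, hn⟩ hz
    have hcomp : IsCompact (closure (higsonMap X '' A)) :=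
      isCompact_higsonCompactification.of_isClosed_subset isClosed_closure
        (closure_mono (image_subset_range _ _))
    -- Finitely many of the open sets where a bump does not vanish cover the closure of `A`.
    obtain ⟨t, ht⟩ := hcomp.elim_finite_subcover
      (fun x : X => {z | z ⟨_, isHigsonFunction_bump x⟩ ≠ 0})
      (fun x => isOpen_ne_fun (continuous_apply _) continuous_const) (fun z hz => by
        obtain ⟨x, rfl⟩ := hsub hz
        exact mem_iUnion.2 ⟨x, by simp [higsonMap]⟩)
    refine ((Bornology.isBounded_biUnion_finset t).2
      fun x _ => Metric.isBounded_ball (x := x) (r := 1)).subset fun y hy => ?_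
    obtain ⟨x, hx, hxy⟩ := mem_iUnion₂.1 (ht (subset_closure (mem_image_of_mem _ hy)))
    refine mem_iUnion₂.2 ⟨x, hx, ?_⟩
    by_contra hn
    rw [Metric.mem_ball, not_lt] at hn
    exact hxy (by simp [higsonMap, hn])
  · exact eq_empty_of_forall_notMem fun z hz => notMem_closure_of_isBounded h z hz

/-- A point at infinity of a set of points at distance less than `ε` from `B` is a point at infinity
of `B`. -/
theorem mem_higsonTrace_of_subset_thickening [ProperSpace X] {C B : Set X} {ε : ℝ}
    (hCB : C ⊆ Metric.thickening ε B) {z : higsonCorona X} (hz : z ∈ higsonTrace C) :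
    z ∈ higsonTrace B := by
  have hnear : ∀ x : X, ∃ y, x ∈ C → y ∈ B ∧ dist x y < ε := fun x => by
    by_cases hx : x ∈ C
    · obtain ⟨y, hy, hxy⟩ := Metric.mem_thickening_iff.1 (hCB hx)
      exact ⟨y, fun _ => ⟨hy, hxy⟩⟩
    · exact ⟨x, fun h => absurd h hx⟩
  choose p hp using hnear
  -- `F` is the trace on `C` of the neighbourhood filter of `z`.
  let F : Filter X := Filter.comap (higsonMap X) (nhds z.1) ⊓ Filter.principal C
  have hF : F.NeBot := by
    have h : (nhds z.1 ⊓ Filter.principal (higsonMap X '' C)).NeBot :=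
      mem_closure_iff_nhdsWithin_neBot.1 hz
    rw [← Filter.map_principal, ← Filter.push_pull'] at h
    exact h.of_map
  have hFC : ∀ᶠ x in F, x ∈ C := Filter.mem_inf_of_right (Filter.mem_principal_self C)
  have hFz : Filter.Tendsto (higsonMap X) F (nhds z.1) :=
    Filter.tendsto_comap.mono_left inf_le_left
  have hFK : ∀ K : Set X, IsCompact K → ∀ᶠ x in F, x ∉ K := fun K hK => by
    have := hFz.eventually (isClosed_closure.isOpen_compl.mem_nhds
      (notMem_closure_of_isBounded hK.isBounded z))
    filter_upwards [this] with x hx hxK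
    exact hx (subset_closure (mem_image_of_mem _ hxK))
  have hlim : Filter.Tendsto (fun x => higsonMap X (p x)) F (nhds z.1) := by
    refine tendsto_pi_nhds.2 fun f => ?_
    have hf : Filter.Tendsto (fun x => f.1 x) F (nhds (z.1 f)) := tendsto_pi_nhds.1 hFz f
    refine (Filter.Tendsto.congr_dist (f₁ := fun x => f.1 x) hf ?_)
    rw [Metric.tendsto_nhds]
    intro δ hδ
    obtain ⟨K, hK, hKf⟩ := f.2.2.2 (max ε 1) (by positivity) δ hδ
    filter_upwards [hFC, hFK K hK] with x hxC hxK
    have := hKf x hxK (p x) (((hp x hxC).2.le).trans (le_max_left _ _))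
    simpa [higsonMap, dist_eq_norm] using this
  refine mem_closure_of_tendsto hlim ?_
  filter_upwards [hFC] with x hx
  exact mem_image_of_mem _ (hp x hx).1

/-- For sets `A`, `B` that are not close, `d(·, A) / (d(·, A) + d(·, B) + 1)` is a Higson
function. -/
theorem isHigsonFunction_of_not_metricRel [ProperSpace X] {A B : Set X} (hA : A.Nonempty)
    (hB : B.Nonempty) (h : ¬ metricRel X A B) : IsHigsonFunction fun x : X =>
      ((Metric.infDist x A / (Metric.infDist x A + Metric.infDist x B + 1) : ℝ) : ℂ) := by
  have hu : ∀ x, 0 ≤ Metric.infDist x A := fun x => Metric.infDist_nonneg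
  have hv : ∀ x, 0 ≤ Metric.infDist x B := fun x => Metric.infDist_nonneg
  have hw : ∀ x, 0 < Metric.infDist x A + Metric.infDist x B + 1 := fun x => by
    linarith [hu x, hv x]
  refine ⟨?_, ⟨1, fun x => ?_⟩, fun r hr ε hε => ?_⟩
  · exact Complex.continuous_ofReal.comp ((Metric.continuous_infDist_pt A).div
      (((Metric.continuous_infDist_pt A).add (Metric.continuous_infDist_pt B)).add
        continuous_const) fun x => (hw x).ne')
  · rw [Complex.norm_real, Real.norm_of_nonneg (div_nonneg (hu x) (hw x).le), div_le_one (hw x)]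
    linarith [hv x]
  · -- The oscillation at `x` is at most `r / (d(x, A) + d(x, B) + 1)`.
    have hbd : Bornology.IsBounded
        {x : X | Metric.infDist x A < r / ε ∧ Metric.infDist x B < r / ε} := by
      have hthick : Bornology.IsBounded (A ∩ Metric.thickening (r / ε + r / ε) B) := by
        by_contra hn
        exact h (metricRel_iff.2 ⟨_, hn⟩)
      refine (hthick.thickening (δ := r / ε)).subset ?_
      rintro x ⟨hxA, hxB⟩
      obtain ⟨a, ha, hxa⟩ := (Metric.infDist_lt_iff hA).1 hxA
      obtain ⟨c, hc, hxc⟩ := (Metric.infDist_lt_iff hB).1 hxB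
      refine Metric.mem_thickening_iff.2 ⟨a, ⟨ha, Metric.mem_thickening_iff.2 ⟨c, hc, ?_⟩⟩, hxa⟩
      linarith [dist_triangle a x c, dist_comm a x]
    refine ⟨_, hbd.isCompact_closure, fun x hx y hxy => ?_⟩
    have hfar : r / ε < Metric.infDist x A + Metric.infDist x B + 1 := by
      by_contra! hcon
      exact hx (subset_closure ⟨by linarith [hv x], by linarith [hu x]⟩)
    have hA' : |Metric.infDist x A - Metric.infDist y A| ≤ r :=
      (by simpa [Real.dist_eq] using (Metric.lipschitz_infDist_pt A).dist_le_mul x y :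
        |Metric.infDist x A - Metric.infDist y A| ≤ dist x y).trans hxy
    have hB' : |Metric.infDist x B - Metric.infDist y B| ≤ r :=
      (by simpa [Real.dist_eq] using (Metric.lipschitz_infDist_pt B).dist_le_mul x y :
        |Metric.infDist x B - Metric.infDist y B| ≤ dist x y).trans hxy
    rw [← Complex.ofReal_sub, Complex.norm_real, Real.norm_eq_abs]
    have hux := hu x
    have huy := hu y
    have hvx := hv x
    have hvy := hv y
    have hwx := hw x
    have hwy := hw y
    generalize Metric.infDist x A = ux at *
    generalize Metric.infDist y A = uy at *
    generalize Metric.infDist x B = vx at *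
    generalize Metric.infDist y B = vy at *
    have hnum : |ux * (uy + vy + 1) - (ux + vx + 1) * uy| ≤ r * (uy + vy + 1) := by
      have e : ux * (uy + vy + 1) - (ux + vx + 1) * uy =
          (ux - uy) * (vy + 1) - uy * (vx - vy) := by ring
      rw [e]
      refine (abs_sub _ _).trans ?_
      rw [abs_mul, abs_mul, abs_of_nonneg huy, abs_of_nonneg (by linarith : 0 ≤ vy + 1)]
      nlinarith [mul_le_mul_of_nonneg_right hA' (by linarith : 0 ≤ vy + 1),
        mul_le_mul_of_nonneg_left hB' huy]
    rw [div_sub_div _ _ hwx.ne' hwy.ne', abs_div, abs_of_pos (mul_pos hwx hwy),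
      div_lt_iff₀ (mul_pos hwx hwy)]
    rw [div_lt_iff₀ hε] at hfar
    nlinarith [mul_lt_mul_of_pos_right hfar hwy]

theorem metricRel_iff_higsonTrace [ProperSpace X] (A B : Set X) :
    metricRel X A B ↔ (higsonTrace A ∩ higsonTrace B).Nonempty := by
  constructor
  · intro h
    obtain ⟨ε, hε⟩ := metricRel_iff.1 h
    obtain ⟨z, hz⟩ := isTraceMap_higsonTrace.nonempty_iff.2 hε
    exact ⟨z, isTraceMap_higsonTrace.mono inter_subset_left hz,
      mem_higsonTrace_of_subset_thickening inter_subset_right hz⟩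
  · rintro ⟨z, hzA, hzB⟩
    by_contra h
    have hA : A.Nonempty := by simpa using closure_nonempty_iff.1 ⟨_, hzA⟩
    have hB : B.Nonempty := by simpa using closure_nonempty_iff.1 ⟨_, hzB⟩
    have hf := isHigsonFunction_of_not_metricRel hA hB h
    have hev : Continuous fun z : {f : X → ℂ // IsHigsonFunction f} → ℂ => z ⟨_, hf⟩ :=
      continuous_apply _
    have h0 : z.1 ⟨_, hf⟩ = 0 := by
      have hcl : IsClosed {w : {f : X → ℂ // IsHigsonFunction f} → ℂ | w ⟨_, hf⟩ = 0} :=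
        isClosed_eq hev continuous_const
      refine closure_minimal ?_ hcl hzA
      rintro _ ⟨x, hx, rfl⟩
      simp [higsonMap, Metric.infDist_zero_of_mem hx]
    -- Outside a bounded set, the points of `B` have distance at least `1` from `A`.
    have hD : Bornology.IsBounded (B ∩ Metric.thickening 1 A) := by
      by_contra hn
      exact h (metricRel_symm (metricRel_iff.2 ⟨_, hn⟩))
    have h1 : 1 / 2 ≤ ‖z.1 ⟨_, hf⟩‖ := by
      refine closure_minimal (t := {w | 1 / 2 ≤ ‖w ⟨_, hf⟩‖}) ?_
        (isClosed_le continuous_const hev.norm)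
        (mem_closure_diff_of_isBounded hD hzB)
      rintro _ ⟨x, ⟨hx, hxD⟩, rfl⟩
      have hxA : 1 ≤ Metric.infDist x A := by
        by_contra! hlt
        obtain ⟨a, ha, hxa⟩ := (Metric.infDist_lt_iff hA).1 hlt
        exact hxD ⟨hx, Metric.mem_thickening_iff.2 ⟨a, ha, hxa⟩⟩
      rw [mem_ofPred_eq, higsonMap, Complex.norm_real, Metric.infDist_zero_of_mem hx, add_zero,
        Real.norm_of_nonneg (by positivity), div_le_div_iff₀ two_pos (by linarith)]
      linarith
    rw [h0] at h1
    norm_num at h1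

end Higson

/-! ### The stitched space -/

/-- No point of the boundary lies in the traces of all unbounded subsets of a given set. -/
theorem exists_unbounded_subset_notMem_coarseTrace {X : Type*} [MetricSpace X] [ProperSpace X]
    {A : Set X} (hA : IsUnbounded (metricBornology X) A) (σ : metricBoundary X) :
    ∃ A₀ ⊆ A, IsUnbounded (metricBornology X) A₀ ∧
      σ ∉ coarseTrace (metricBornology X) (metricRel X) A₀ := by
  obtain ⟨A₁, h1, A₂, h2, hu1, hu2, hn⟩ := exists_unbounded_not_metricRel hA
  obtain ⟨h, hh⟩ := isTraceMap_higsonTrace.exists_homeomorph (metricRel_iff_higsonTrace (X := X))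
  by_contra! hcon
  obtain ⟨z, rfl⟩ := h.surjective σ
  exact hn ((metricRel_iff_higsonTrace _ _).2
    ⟨z, (hh _ _).1 (hcon A₁ h1 hu1), (hh _ _).1 (hcon A₂ h2 hu2)⟩)

theorem isTraceMap_metric_coarseTrace {X : Type*} [MetricSpace X] [ProperSpace X] :
    IsTraceMap (metricBornology X) (coarseTrace (metricBornology X) (metricRel X)) :=
  isTraceMap_higsonTrace.isTraceMap_coarseTrace metricRel_iff_higsonTrace

theorem isTraceMap_example_stitchTrace {X : Type*} [MetricSpace X] [ProperSpace X]
    (h : metricBoundary X ≃ₜ higsonCorona X)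
    (k : higsonCorona X ≃ₜ boxBoundary (higsonCorona X)) :
    IsTraceMap (exampleBornology X) (stitchTrace (coronaGluing h k)) :=
  isTraceMap_metric_coarseTrace.isTraceMap_stitchTrace
    ((isTraceMap_boxTrace _).isTraceMap_coarseTrace boxRel_iff_boxTrace) _

theorem isCoarseProximity_exampleRel {X : Type*} [MetricSpace X] [ProperSpace X]
    (h : metricBoundary X ≃ₜ higsonCorona X)
    (k : higsonCorona X ≃ₜ boxBoundary (higsonCorona X)) :
    IsCoarseProximity (exampleBornology X) (exampleRel h k) :=
  have hT := isTraceMap_example_stitchTrace h k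
  hT.isCoarseProximity hT.stitchRel_iff

theorem image_coarseTrace_ne_singleton {X : Type*} [MetricSpace X] [ProperSpace X]
    (h : metricBoundary X ≃ₜ higsonCorona X) (x₀ : higsonCorona X) {A : Set X}
    (hA : IsUnbounded (metricBornology X) A) :
    h '' coarseTrace (metricBornology X) (metricRel X) A ≠ {x₀} := by
  intro heq
  obtain ⟨A₀, hA₀, hu, hn⟩ := exists_unbounded_subset_notMem_coarseTrace hA (h.symm x₀)
  obtain ⟨σ, hσ⟩ := isTraceMap_metric_coarseTrace.nonempty_iff.2 hu
  have hσx : h σ = x₀ :=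
    heq.subset (mem_image_of_mem h (isTraceMap_metric_coarseTrace.mono hA₀ hσ))
  rw [← hσx, h.symm_apply_apply] at hn
  exact hn hσ

/-- The trace of `{x₀} × [0,1)` is a single point. -/
theorem coarseTrace_box_fiber {Z : Type*} [TopologicalSpace Z] [T2Space Z]
    {k : Z ≃ₜ boxBoundary Z} (hk : IsBoxIdentification k) (z : Z) :
    coarseTrace (boxBornology Z) (boxRel Z) {p : Box Z | p.1 = z} = {k z} := by
  ext σ
  obtain ⟨w, rfl⟩ := k.surjective σ
  rw [hk, mem_singleton_iff, k.injective.eq_iff]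
  refine ⟨fun hw => ?_, fun hw => hw ▸ boxEnd_mem_closure_fiber w⟩
  refine closure_minimal (t := {q : Z × Icc (0 : ℝ) 1 | q.1 = z}) ?_
    (isClosed_eq continuous_fst continuous_const) hw
  rintro _ ⟨p, hp, rfl⟩
  exact hp

theorem stitchTrace_fiber {X : Type*} [MetricSpace X] [ProperSpace X]
    (h : metricBoundary X ≃ₜ higsonCorona X)
    {k : higsonCorona X ≃ₜ boxBoundary (higsonCorona X)} (hk : IsBoxIdentification k)
    (x₀ : higsonCorona X) :
    stitchTrace (coronaGluing h k) (Sum.inr '' {p : Box (higsonCorona X) | p.1 = x₀}) =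
      {h.symm x₀} := by
  have h0 : coarseTrace (metricBornology X) (metricRel X) ∅ = ∅ :=
    (isTraceMap_metric_coarseTrace.eq_empty_iff ∅).2 Bornology.isBounded_empty
  rw [stitchTrace, preimage_inl_image_inr, preimage_image_eq _ Sum.inr_injective,
    coarseTrace_box_fiber hk, h0, empty_union, image_singleton]
  simp [coronaGluing]

theorem stitchTrace_image_inl {X : Type*} [MetricSpace X] [ProperSpace X]
    (h : metricBoundary X ≃ₜ higsonCorona X)
    (k : higsonCorona X ≃ₜ boxBoundary (higsonCorona X)) (B : Set X) :
    stitchTrace (coronaGluing h k) (Sum.inl '' B) =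
      coarseTrace (metricBornology X) (metricRel X) B := by
  have h0 : coarseTrace (boxBornology (higsonCorona X)) (boxRel (higsonCorona X)) ∅ = ∅ :=
    (((isTraceMap_boxTrace _).isTraceMap_coarseTrace boxRel_iff_boxTrace).eq_empty_iff ∅).2
      (@Bornology.isBounded_empty _ (boxBornology (higsonCorona X)))
  rw [stitchTrace, preimage_inr_image_inl, preimage_image_eq _ Sum.inl_injective, h0, image_empty,
    union_empty]

/-- The trace of `A` has at most one point, and some unbounded part of `B` avoids it. -/
theorem not_weakResemblance_of_subset_fiber {X : Type*} [MetricSpace X] [ProperSpace X]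
    (h : metricBoundary X ≃ₜ higsonCorona X)
    {k : higsonCorona X ≃ₜ boxBoundary (higsonCorona X)} (hk : IsBoxIdentification k)
    (x₀ : higsonCorona X) {A B : Set (X ⊕ Box (higsonCorona X))}
    (hA : A ⊆ Sum.inr '' {p : Box (higsonCorona X) | p.1 = x₀}) (hB : B ⊆ range Sum.inl)
    (hBu : IsUnbounded (exampleBornology X) B) :
    ¬ WeakResemblance (exampleBornology X) (exampleRel h k) A B := by
  intro hw
  have hT := isTraceMap_example_stitchTrace h k
  obtain ⟨C, rfl⟩ := subset_range_iff_exists_image_eq.1 hB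
  rw [← hT.nonempty_iff, stitchTrace_image_inl, isTraceMap_metric_coarseTrace.nonempty_iff] at hBu
  -- An unbounded part of `B` whose trace misses the only point in the trace of `A`.
  obtain ⟨C₀, hC, hu, hn⟩ := exists_unbounded_subset_notMem_coarseTrace hBu (h.symm x₀)
  obtain ⟨-, -, σ, hσA, hσC⟩ := hw.1 (Sum.inl '' C₀) (image_mono hC) (by
    rwa [← hT.nonempty_iff, stitchTrace_image_inl, isTraceMap_metric_coarseTrace.nonempty_iff])
  rw [stitchTrace_image_inl] at hσC
  have hσ := hT.mono hA hσA
  rw [stitchTrace_fiber h hk, mem_singleton_iff] at hσ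
  exact hn (hσ ▸ hσC)

theorem exampleRel_fiber_range_inl {X : Type*} [MetricSpace X] [ProperSpace X]
    (h : metricBoundary X ≃ₜ higsonCorona X)
    {k : higsonCorona X ≃ₜ boxBoundary (higsonCorona X)} (hk : IsBoxIdentification k)
    (x₀ : higsonCorona X) :
    exampleRel h k (Sum.inr '' {p : Box (higsonCorona X) | p.1 = x₀}) (range Sum.inl) := by
  refine ((isTraceMap_example_stitchTrace h k).stitchRel_iff _ _).2 ⟨h.symm x₀, ?_, ?_⟩
  · rw [stitchTrace_fiber h hk]
    rfl
  · rw [← image_univ, stitchTrace_image_inl, isTraceMap_metric_coarseTrace.univ]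
    trivial

theorem nonempty_higsonCorona {X : Type*} [MetricSpace X] [ProperSpace X]
    (hX : IsUnbounded (metricBornology X) (univ : Set X)) : (higsonCorona X).Nonempty :=
  let ⟨z, _⟩ := isTraceMap_higsonTrace.nonempty_iff.2 hX
  ⟨z.1, z.2⟩

theorem exists_isHigsonIdentification (X : Type*) [MetricSpace X] [ProperSpace X] :
    ∃ h : metricBoundary X ≃ₜ higsonCorona X, IsHigsonIdentification h := by
  obtain ⟨h, hh⟩ := isTraceMap_higsonTrace.exists_homeomorph (metricRel_iff_higsonTrace (X := X))
  refine ⟨h.symm, fun A σ => ?_⟩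
  have := hh A (h.symm σ)
  rwa [h.apply_symm_apply] at this

theorem exists_isBoxIdentification (Z : Type*) [TopologicalSpace Z] [CompactSpace Z] [T2Space Z] :
    ∃ k : Z ≃ₜ boxBoundary Z, IsBoxIdentification k :=
  (isTraceMap_boxTrace Z).exists_homeomorph boxRel_iff_boxTrace

theorem not_isInducedByResemblance_exampleRel {X : Type*} [MetricSpace X] [ProperSpace X]
    (hX : IsUnbounded (metricBornology X) (univ : Set X))
    (h : metricBoundary X ≃ₜ higsonCorona X)
    {k : higsonCorona X ≃ₜ boxBoundary (higsonCorona X)} (hk : IsBoxIdentification k) :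
    ¬ IsInducedByResemblance (exampleBornology X) (exampleRel h k) := by
  rintro ⟨r, hr, hi⟩
  obtain ⟨x₀, hx₀⟩ := nonempty_higsonCorona hX
  obtain ⟨A, hA, B, hB, -, hBu, hw⟩ := hi.exists_weakResemblance
    (isCoarseProximity_exampleRel h k) hr (exampleRel_fiber_range_inl h hk ⟨x₀, hx₀⟩)
  exact not_weakResemblance_of_subset_fiber h hk _ hA hB hBu hw

theorem mainTheorem3 :
    -- some coarse proximity space is not induced by any asymptotic resemblance
    (∃ (W : Type) (𝓑 : Bornology W) (b : Set W → Set W → Prop),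
      IsCoarseProximity 𝓑 b ∧ ¬ IsInducedByResemblance 𝓑 b) ∧
    -- close sets of an induced space contain weakly resembling unbounded sets
    (∀ (W : Type*) (𝓑 : Bornology W) (b r : Set W → Set W → Prop),
      IsCoarseProximity 𝓑 b → IsAsymptoticResemblance r → InducesCoarseProximity r 𝓑 b →
      ∀ A₁ B₁ : Set W, IsUnbounded 𝓑 A₁ → IsUnbounded 𝓑 B₁ → b A₁ B₁ →
        ∃ A₂ ⊆ A₁, ∃ B₂ ⊆ B₁, IsUnbounded 𝓑 A₂ ∧ IsUnbounded 𝓑 B₂ ∧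
          WeakResemblance 𝓑 b A₂ B₂) ∧
    -- the stitched spaces
    (∀ (X : Type*) [MetricSpace X] [ProperSpace X],
      IsUnbounded (metricBornology X) (Set.univ : Set X) →
      IsCoarseProximity (metricBornology X) (metricRel X) ∧
      IsCoarseProximity (boxBornology (higsonCorona X)) (boxRel (higsonCorona X)) ∧
      (higsonCorona X).Nonempty ∧
      (∃ h : metricBoundary X ≃ₜ higsonCorona X, IsHigsonIdentification h) ∧
      (∃ k : higsonCorona X ≃ₜ boxBoundary (higsonCorona X), IsBoxIdentification k) ∧
      ∀ (h : metricBoundary X ≃ₜ higsonCorona X)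
        (k : higsonCorona X ≃ₜ boxBoundary (higsonCorona X)), IsBoxIdentification k →
        IsCoarseProximity (exampleBornology X) (exampleRel h k) ∧
        (∀ (x₀ : higsonCorona X) (A : Set X), IsUnbounded (metricBornology X) A →
          h '' coarseTrace (metricBornology X) (metricRel X) A ≠ {x₀}) ∧
        (∀ (x₀ : higsonCorona X) (A₁ B₁ : Set (X ⊕ Box (higsonCorona X))),
          A₁ = Sum.inr '' {p : Box (higsonCorona X) | p.1 = x₀} →
          B₁ = Set.range Sum.inl →
          IsUnbounded (exampleBornology X) A₁ ∧ IsUnbounded (exampleBornology X) B₁ ∧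
          exampleRel h k A₁ B₁ ∧
          ∀ A₂ ⊆ A₁, ∀ B₂ ⊆ B₁,
            IsUnbounded (exampleBornology X) A₂ → IsUnbounded (exampleBornology X) B₂ →
            ¬ WeakResemblance (exampleBornology X) (exampleRel h k) A₂ B₂) ∧
        ¬ IsInducedByResemblance (exampleBornology X) (exampleRel h k)) := by
  refine ⟨?_, ?_, ?_⟩
  · have hX : IsUnbounded (metricBornology ℝ) (Set.univ : Set ℝ) :=
      fun hb => noncompact_univ ℝ (Metric.isCompact_of_isClosed_isBounded isClosed_univ hb)
    obtain ⟨h, -⟩ := exists_isHigsonIdentification ℝ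
    obtain ⟨k, hk⟩ := exists_isBoxIdentification (higsonCorona ℝ)
    exact ⟨_, _, _, isCoarseProximity_exampleRel h k,
      not_isInducedByResemblance_exampleRel hX h hk⟩
  · intro W 𝓑 b r hb hr hi A₁ B₁ _ _ hAB
    exact hi.exists_weakResemblance hb hr hAB
  · intro X _ _ hX
    refine ⟨isTraceMap_higsonTrace.isCoarseProximity metricRel_iff_higsonTrace,
      (isTraceMap_boxTrace _).isCoarseProximity boxRel_iff_boxTrace, nonempty_higsonCorona hX,
      exists_isHigsonIdentification X, exists_isBoxIdentification _, fun h k hk =>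
      ⟨isCoarseProximity_exampleRel h k, fun x₀ A hA => image_coarseTrace_ne_singleton h x₀ hA,
        ?_, not_isInducedByResemblance_exampleRel hX h hk⟩⟩
    rintro x₀ _ _ rfl rfl
    have hrel := exampleRel_fiber_range_inl h hk x₀
    exact ⟨hrel.1, hrel.2.1, hrel, fun A hA B hB _ hBu =>
      not_weakResemblance_of_subset_fiber h hk x₀ hA hB hBu⟩
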